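/- Let $Z_1,Z_2,\dots$ be i.i.d. real random variables with distribution $P$. Suppose that, for some $\delta>0$, $P$ is absolutely continuous with respect to Lebesgue measure on $(-\delta,\delta)$ with a density $f$ there (no assumption is made on $P$ outside $(-\delta,\delta)$; in particular atoms are allowed there), that $f$ is bounded on $(-\delta,\delta)$, that the one-sided limits $f^{+}(0)=\lim_{z\downarrow 0}f(z)$ and $f^{-}(0)=\lim_{z\uparrow 0}f(z)$ exist and are finite, and that $f^{-}(0)+f^{+}(0)>0$. Let $q\ge 1$ be a fixed integer. For each $n$, let $Z_{g,(1)},\dots,Z_{g,(n)}$ be a rearrangement of $Z_1,\dots,Z_n$ with $|Z_{g,(1)}|\le\dots\le|Z_{g,(n)}|$, where ties are broken in an arbitrary (measurable) way, and let $$S_n=\sum_{j\le q} I\{Z_{g,(j)}\ge 0\}$$ be the number of non-negative values among the $q$ observations closest to $0$ (when $n<q$, which is irrelevant for the limit, the sum is over $j\le n$). Then, as $n\to\infty$, $$S_n\xrightarrow{d}\mathrm{Binomial}(q,\pi_f),\qquad \pi_f=\frac{f^{+}(0)}{f^{-}(0)+f^{+}(0)}\in[0,1].$$ -/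

import Mathlib

open MeasureTheory ProbabilityTheory Filter Topology Set

/-- `y 0, …, y (n-1)` are `g`-order statistics of the sample `z 0, …, z (n-1)`: a rearrangement
of the sample along which `g` is non-decreasing. Ties in `g` may be broken in any way. -/
def IsGOrderStatistics {n : ℕ} (g : ℝ → ℝ) (z y : Fin n → ℝ) : Prop :=
  (∃ σ : Equiv.Perm (Fin n), ∀ j, y j = z (σ j)) ∧ Monotone fun j => g (y j)

/-- The number of non-negative values among the first `q` entries of `y`
(among all the entries, if there are fewer than `q` of them). -/
noncomputable def signCount {n : ℕ} (q : ℕ) (y : Fin n → ℝ) : ℕ :=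
  ∑ j : Fin n, if (j : ℕ) < q ∧ 0 ≤ y j then 1 else 0

/-- On the set `s`, the measure `P` is absolutely continuous with respect to Lebesgue measure,
with density `f`. Nothing is said about `P` or `f` outside `s`. -/
structure HasDensityOn (P : Measure ℝ) (f : ℝ → ℝ) (s : Set ℝ) : Prop where
  aemeasurable : AEMeasurable f (volume.restrict s)
  nonneg : ∀ z ∈ s, 0 ≤ f z
  restrict_eq : P.restrict s = (volume.restrict s).withDensity fun z => ENNReal.ofReal (f z)

/-! Generating functions on the unit circle. For a `q`-set `A` of indices, `closestWeight x A` is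
`x` to the sign count of `A` if `A` holds the strictly closest values, and `0` otherwise. At most
one `A` contributes, and almost surely, for large `n`, exactly one does: there are no ties below `δ`
and eventually `q` values fall there (`tendsto_integral_pow_signCount_sub`). Given the values `w`
outside `A`, those inside are i.i.d. and must lie in `(-m, m)`, `m` being the least outside absolute
value; the conditional mean is the `q`-th power of the integral of `signWeight x` over that interval
(`integral_closestWeight`). For small `m` the one-sided limits of `f` make this integral nearly `c *
P(-m, m)`, where `c = π x + (1 - π)` is the Bernoulli generating function. So each term is nearly `c
^ q` times the same term at `x = 1`, and the terms at `x = 1` sum to the probability that some `A`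
separates, which tends to `1`. The event that `m` is not small costs at most `2 * n.choose q * r ^
(n - q)` with `r < 1`. With `x = exp (i t)` this is convergence of characteristic functions. -/

/-! ### Separated index sets and their weights -/

/-- Every value with index in `A` is strictly closer to `0` than every other value. -/
def Separates {ι : Type*} (A : Finset ι) (z : ι → ℝ) : Prop :=
  ∀ i ∈ A, ∀ j ∉ A, |z i| < |z j|

/-- The weight `x` for non-negative reals, and `1` for negative ones. -/
noncomputable def signWeight (x : ℂ) (z : ℝ) : ℂ := if 0 ≤ z then x else 1

open Classical in
/-- `x` to the number of non-negative values in `A`, if these are the values closest to `0`. -/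
noncomputable def closestWeight {ι : Type*} (x : ℂ) (A : Finset ι) (z : ι → ℝ) : ℂ :=
  if Separates A z then ∏ i ∈ A, signWeight x (z i) else 0

/-- The reals strictly closer to `0` than all the `w j`. -/
def closerSet {κ : Type*} (w : κ → ℝ) : Set ℝ := {z | ∀ j, |z| < |w j|}

theorem norm_signWeight {x : ℂ} (hx : ‖x‖ = 1) (z : ℝ) : ‖signWeight x z‖ = 1 := by
  unfold signWeight; split_ifs <;> simp [hx]

theorem measurable_signWeight (x : ℂ) : Measurable (signWeight x) :=
  Measurable.ite measurableSet_Ici measurable_const measurable_const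

theorem prod_signWeight {ι : Type*} (x : ℂ) (A : Finset ι) (z : ι → ℝ) :
    ∏ i ∈ A, signWeight x (z i) = x ^ ∑ i ∈ A, if 0 ≤ z i then 1 else 0 := by
  rw [← Finset.prod_pow_eq_pow_sum]
  refine Finset.prod_congr rfl fun i _ => ?_
  unfold signWeight; split_ifs <;> simp

/-- An index in `A \ B` and one in `B \ A` would each be strictly closer to `0` than the other. -/
theorem Separates.eq {ι : Type*} {A B : Finset ι} {z : ι → ℝ}
    (hA : Separates A z) (hB : Separates B z) (h : A.card = B.card) : A = B := by
  by_contra hne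
  have h1 : ¬ A ⊆ B := fun hs => hne (Finset.eq_of_subset_of_card_le hs h.ge)
  have h2 : ¬ B ⊆ A := fun hs => hne (Finset.eq_of_subset_of_card_le hs h.le).symm
  obtain ⟨i, hiA, hiB⟩ := Finset.not_subset.1 h1
  obtain ⟨j, hjB, hjA⟩ := Finset.not_subset.1 h2
  exact lt_asymm (hA i hiA j hjA) (hB j hjB i hiB)

theorem sum_closestWeight_eq {ι : Type*} [Fintype ι] {x : ℂ} {q : ℕ} {z : ι → ℝ} {A : Finset ι}
    (hA : Separates A z) (hq : A.card = q) :
    ∑ B ∈ Finset.powersetCard q Finset.univ, closestWeight x B z =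
      ∏ i ∈ A, signWeight x (z i) := by
  rw [Finset.sum_eq_single A]
  · simp [closestWeight, hA]
  · intro B hB hne
    refine if_neg fun hs => hne (hs.eq hA ?_)
    rw [hq, (Finset.mem_powersetCard.1 hB).2]
  · simp [Finset.mem_powersetCard, hq]

theorem norm_sum_closestWeight_le {ι : Type*} [Fintype ι] {x : ℂ} (hx : ‖x‖ = 1) (q : ℕ)
    (z : ι → ℝ) : ‖∑ B ∈ Finset.powersetCard q Finset.univ, closestWeight x B z‖ ≤ 1 := by
  by_cases h : ∃ A : Finset ι, A.card = q ∧ Separates A z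
  · obtain ⟨A, hq, hA⟩ := h
    simp [sum_closestWeight_eq hA hq, norm_signWeight hx]
  · rw [Finset.sum_eq_zero]
    · simp
    · exact fun B hB => if_neg fun hs => h ⟨B, (Finset.mem_powersetCard.1 hB).2, hs⟩

/-- If no ties occur below `δ` and at least `q` values are below `δ`, the `q` closest values
are determined by the sample. -/
theorem exists_separates_of_isGOrderStatistics {n q : ℕ} {δ : ℝ} {z y : Fin n → ℝ}
    (h : IsGOrderStatistics (fun z => |z|) z y)
    (htie : ∀ i j, i ≠ j → |z i| = |z j| → δ ≤ |z i|)
    (hcard : q ≤ (Finset.univ.filter fun i => |z i| < δ).card) :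
    ∃ A : Finset (Fin n), A.card = q ∧ Separates A z ∧
      signCount q y = ∑ i ∈ A, if 0 ≤ z i then 1 else 0 := by
  obtain ⟨⟨σ, hσ⟩, hmono⟩ := h
  have hqn : q ≤ n := hcard.trans ((Finset.card_le_univ _).trans (by simp))
  refine ⟨(Finset.univ.filter fun j : Fin n => (j : ℕ) < q).map σ.toEmbedding, ?_, ?_, ?_⟩
  · rw [Finset.card_map, Fin.card_filter_val_lt, min_eq_right hqn]
  · intro i hi j hj
    obtain ⟨a, ha, rfl⟩ := Finset.mem_map.1 hi
    obtain ⟨b, rfl⟩ := σ.surjective j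
    simp only [Finset.mem_filter, Finset.mem_univ, true_and] at ha
    have hb : q ≤ (b : ℕ) := by simpa using hj
    have hab : a < b := Fin.lt_def.2 (ha.trans_le hb)
    have hle : |z (σ a)| ≤ |z (σ b)| := by
      have := hmono hab.le
      simpa [hσ] using this
    -- A tie across rank `q` would sit at level at least `δ`. All values below `δ` would then have
    -- rank below `a < q`, which leaves fewer than `q` of them.
    refine lt_of_le_of_ne hle fun he => ?_
    have hδ : δ ≤ |z (σ a)| := htie _ _ (σ.injective.ne hab.ne) he
    have hsub : (Finset.univ.filter fun i => |z i| < δ) ⊆ (Finset.Iio a).map σ.toEmbedding := by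
      intro i hi
      obtain ⟨c, rfl⟩ := σ.surjective i
      simp only [Finset.mem_filter, Finset.mem_univ, true_and] at hi
      refine Finset.mem_map_of_mem σ.toEmbedding (Finset.mem_Iio.2 ?_)
      by_contra hca
      have := hmono (not_lt.1 hca)
      simp only [hσ] at this
      linarith
    have := hcard.trans (Finset.card_le_card hsub)
    rw [Finset.card_map, Fin.card_Iio] at this
    omega
  · rw [Finset.sum_map, Finset.sum_filter, signCount]
    refine Finset.sum_congr rfl fun j _ => ?_
    simp only [hσ, Equiv.coe_toEmbedding]
    split_ifs <;> first | rfl | tauto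

/-- Once the outside values are fixed, separation is a condition on each inside value on its own.
The weight thus factors over the inside coordinates, as Fubini requires. -/
theorem closestWeight_eq_prod_indicator {ι : Type*} (x : ℂ) (A : Finset ι) (z : ι → ℝ) :
    closestWeight x A z = ∏ i : {i // i ∈ A},
      (closerSet fun j : {j // j ∉ A} => z j).indicator (signWeight x) (z i) := by
  classical
  by_cases h : Separates A z
  · rw [closestWeight, if_pos h, ← Finset.prod_coe_sort]
    refine Finset.prod_congr rfl fun i _ => ?_
    rw [indicator_of_mem]
    exact fun j => h i i.2 j j.2
  · rw [closestWeight, if_neg h]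
    simp only [Separates, not_forall] at h
    obtain ⟨i, hi, j, hj, hij⟩ := h
    refine (Finset.prod_eq_zero (Finset.mem_univ ⟨i, hi⟩) (indicator_of_notMem ?_ _)).symm
    exact fun h => hij (h ⟨j, hj⟩)

theorem measurableSet_closerSet {κ : Type*} [Countable κ] :
    MeasurableSet {p : ℝ × (κ → ℝ) | p.1 ∈ closerSet p.2} := by
  have : {p : ℝ × (κ → ℝ) | p.1 ∈ closerSet p.2} = ⋂ j, {p | |p.1| < |p.2 j|} := by
    ext; simp [closerSet]
  rw [this]
  exact MeasurableSet.iInter fun j => measurableSet_lt (by fun_prop) (by fun_prop)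

theorem measurable_indicator_closerSet {κ : Type*} [Countable κ] (x : ℂ) :
    Measurable fun p : ℝ × (κ → ℝ) => (closerSet p.2).indicator (signWeight x) p.1 := by
  classical
  exact Measurable.ite measurableSet_closerSet ((measurable_signWeight x).comp measurable_fst)
    measurable_const

theorem norm_indicator_signWeight_le {x : ℂ} (hx : ‖x‖ = 1) (s : Set ℝ) (z : ℝ) :
    ‖s.indicator (signWeight x) z‖ ≤ 1 :=
  (norm_indicator_le_norm_self _ _).trans (norm_signWeight hx z).le

theorem measurable_closestWeight {ι : Type*} [Fintype ι] (x : ℂ) (A : Finset ι) :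
    Measurable (closestWeight x A) := by
  simp_rw [funext (closestWeight_eq_prod_indicator x A)]
  refine Finset.measurable_prod _ fun i _ => ?_
  exact (measurable_indicator_closerSet x).comp
    (f := fun z : ι → ℝ => (z i, fun j : {j // j ∉ A} => z j)) (by fun_prop)

theorem norm_closestWeight_le {ι : Type*} {x : ℂ} (hx : ‖x‖ = 1) (A : Finset ι) (z : ι → ℝ) :
    ‖closestWeight x A z‖ ≤ 1 := by
  unfold closestWeight; split_ifs <;> simp [norm_signWeight hx]

/-! ### Conditioning on the values outside `A` -/

section Fubini

variable {α κ ι : Type*} [Fintype α] [Fintype κ] (P : Measure ℝ) [IsProbabilityMeasure P] {x : ℂ}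

theorem integral_prod_indicator_closerSet (w : κ → ℝ) :
    ∫ a, ∏ i, (closerSet w).indicator (signWeight x) (a i) ∂Measure.pi (fun _ : α => P) =
      (∫ z in closerSet w, signWeight x z ∂P) ^ Fintype.card α := by
  have hm : MeasurableSet (closerSet w) := measurableSet_closerSet.preimage
    (f := fun z : ℝ => (z, w)) (by fun_prop)
  rw [integral_fintype_prod_eq_prod
    (f := fun (_ : α) (z : ℝ) => (closerSet w).indicator (signWeight x) z)]
  simp [integral_indicator hm]

theorem integrable_prod_indicator_closerSet (hx : ‖x‖ = 1) :
    Integrable (fun p : (α → ℝ) × (κ → ℝ) =>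
      ∏ i, (closerSet p.2).indicator (signWeight x) (p.1 i))
      ((Measure.pi fun _ => P).prod (Measure.pi fun _ => P)) := by
  refine Integrable.of_bound (C := 1) ?_ (Eventually.of_forall fun p => ?_)
  · refine (Finset.measurable_prod _ fun i _ => ?_).aestronglyMeasurable
    exact (measurable_indicator_closerSet x).comp
      (f := fun p : (α → ℝ) × (κ → ℝ) => (p.1 i, p.2)) (by fun_prop)
  · rw [norm_prod]
    exact Finset.prod_le_one (fun _ _ => norm_nonneg _)
      fun _ _ => norm_indicator_signWeight_le hx _ _

/-- The integrand is a marginal of an integrable function on a product with `q` inside coordinates.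
-/
theorem integrable_setIntegral_closerSet_pow (hx : ‖x‖ = 1) (q : ℕ) :
    Integrable (fun w : κ → ℝ => (∫ z in closerSet w, signWeight x z ∂P) ^ q)
      (Measure.pi fun _ => P) := by
  have := (integrable_prod_indicator_closerSet (α := Fin q) (κ := κ) P hx).integral_prod_right
  simpa only [integral_prod_indicator_closerSet, Fintype.card_fin] using this

/-- Conditionally on the values outside `A`, those in `A` are an i.i.d. sample. -/
theorem integral_closestWeight [Fintype ι] [DecidableEq ι] (hx : ‖x‖ = 1) (A : Finset ι) :
    ∫ z, closestWeight x A z ∂Measure.pi (fun _ : ι => P) =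
      ∫ w, (∫ z in closerSet w, signWeight x z ∂P) ^ A.card
        ∂Measure.pi (fun _ : {j // j ∉ A} => P) := by
  have hmp := measurePreserving_piEquivPiSubtypeProd (fun _ : ι => P) (fun i => i ∈ A)
  let _ : Fintype {i // i ∈ A} := Subtype.fintype fun i => i ∈ A
  have h := hmp.integral_comp' (fun p : ({i // i ∈ A} → ℝ) × ({j // j ∉ A} → ℝ) =>
      ∏ i, (closerSet p.2).indicator (signWeight x) (p.1 i))
  simp_rw [closestWeight_eq_prod_indicator]
  refine Eq.trans ?_ (h.trans ?_)
  · refine integral_congr_ae (Eventually.of_forall fun z => ?_)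
    exact Finset.prod_congr (by ext; simp) fun _ _ => rfl
  · rw [integral_prod_symm _ (integrable_prod_indicator_closerSet P hx)]
    simp_rw [integral_prod_indicator_closerSet, Fintype.card_subtype]
    simp

end Fubini

/-! ### Behaviour of `P` near `0` -/

section Density

variable {P : Measure ℝ} {f : ℝ → ℝ} {δ : ℝ}

theorem HasDensityOn.null_of_subset {s t : Set ℝ} (hf : HasDensityOn P f s) (hs : MeasurableSet s)
    (hts : t ⊆ s) (ht : volume t = 0) : P t = 0 := by
  have h1 : volume.restrict s t = 0 := nonpos_iff_eq_zero.1 ((Measure.restrict_apply_le _ _).trans ht.le)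
  have h2 : P.restrict s t = 0 := by
    rw [hf.restrict_eq]; exact withDensity_absolutelyContinuous _ _ h1
  rwa [Measure.restrict_apply' hs, inter_eq_self_of_subset_left hts] at h2

/-- If `f` is uniformly close to `c` on `s` away from `0`, then `P s` is close to `c * volume s`. -/
theorem HasDensityOn.abs_measureReal_sub_le {s t : Set ℝ} (hf : HasDensityOn P f s)
    (ht : MeasurableSet t) (hts : t ⊆ s) {c η m : ℝ} (hm : 0 ≤ m)
    (hvol : volume t = ENNReal.ofReal m) (h : ∀ z ∈ t, z ≠ 0 → |f z - c| ≤ η) :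
    |P.real t - c * m| ≤ η * m := by
  have hfin : volume t < ⊤ := by rw [hvol]; exact ENNReal.ofReal_lt_top
  have hae : ∀ᵐ z ∂volume, z ∈ t → ‖f z - c‖ ≤ η := by
    filter_upwards [Measure.ae_ne volume (0 : ℝ)] with z hz hzt using h z hzt hz
  have hmeas : AEStronglyMeasurable f (volume.restrict t) :=
    (hf.aemeasurable.mono_measure (Measure.restrict_mono hts le_rfl)).aestronglyMeasurable
  have hsub : IntegrableOn (fun z => f z - c) t :=
    IntegrableOn.of_bound hfin (hmeas.sub aestronglyMeasurable_const) η
      ((ae_restrict_iff' ht).2 hae)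
  have hint : IntegrableOn f t := by
    have := hsub.add (integrableOn_const (C := c) hfin.ne)
    simpa [Pi.add_def] using this
  have hP : P.real t = ∫ z in t, f z := by
    rw [integral_eq_lintegral_of_nonneg_ae
      ((ae_restrict_iff' ht).2 (Eventually.of_forall fun z hz => hf.nonneg z (hts hz))) hmeas,
      measureReal_def, ← Measure.restrict_eq_self P hts, hf.restrict_eq, withDensity_apply _ ht,
      Measure.restrict_restrict ht, inter_eq_self_of_subset_left hts]
  have hreal : volume.real t = m := by rw [measureReal_def, hvol, ENNReal.toReal_ofReal hm]
  have hkey : P.real t - c * m = ∫ z in t, (f z - c) := by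
    rw [integral_sub hint (integrableOn_const hfin.ne), hP]
    simp [hreal, mul_comm]
  rw [hkey, ← Real.norm_eq_abs, ← hreal]
  exact norm_setIntegral_le_of_norm_le_const_ae' hfin hae

theorem setIntegral_signWeight [IsProbabilityMeasure P] (x : ℂ) {m : ℝ} (hm : 0 < m) :
    ∫ z in Ioo (-m) m, signWeight x z ∂P = P.real (Ico 0 m) * x + P.real (Ioo (-m) 0) := by
  have hint : ∀ s, MeasurableSet s → IntegrableOn (signWeight x) s P := by
    refine fun s _ => Integrable.of_bound (C := max ‖x‖ 1)
      (measurable_signWeight x).aestronglyMeasurable (Eventually.of_forall fun z => ?_)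
    unfold signWeight; split_ifs <;> simp
  rw [← Ioo_union_Ico_eq_Ioo (neg_neg_of_pos hm) hm.le, setIntegral_union
    (disjoint_left.2 fun z h1 h2 => not_lt.2 h2.1 h1.2) measurableSet_Ico
    (hint _ measurableSet_Ioo) (hint _ measurableSet_Ico),
    setIntegral_congr_fun (f := signWeight x) (g := fun _ => (1 : ℂ)) measurableSet_Ioo
      fun z hz => if_neg (not_le.2 hz.2),
    setIntegral_congr_fun (f := signWeight x) (g := fun _ => x) measurableSet_Ico fun z hz => if_pos hz.1]
  simp [add_comm]

theorem measureReal_Ioo_neg [IsProbabilityMeasure P] {m : ℝ} (hm : 0 < m) :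
    P.real (Ioo (-m) m) = P.real (Ico 0 m) + P.real (Ioo (-m) 0) := by
  rw [← Ioo_union_Ico_eq_Ioo (neg_neg_of_pos hm) hm.le, measureReal_union
    (disjoint_left.2 fun z h1 h2 => not_lt.2 h2.1 h1.2) measurableSet_Ico, add_comm]

/-- Near `0`, conditionally on the absolute value being below `m`, the mean of `signWeight x`
is close to its limit. -/
theorem HasDensityOn.exists_norm_setIntegral_signWeight_sub_le [IsProbabilityMeasure P]
    (hδ : 0 < δ) (hf : HasDensityOn P f (Ioo (-δ) δ)) {fplus fminus : ℝ}
    (hplus : Tendsto f (𝓝[>] 0) (𝓝 fplus)) (hminus : Tendsto f (𝓝[<] 0) (𝓝 fminus))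
    (hp : 0 ≤ fplus) (hm : 0 ≤ fminus) (hpos : 0 < fminus + fplus)
    {x : ℂ} (hx : ‖x‖ = 1) {η : ℝ} (hη : 0 < η) :
    ∃ ε > 0, ∀ m ∈ Ioc 0 ε, 0 < P.real (Ioo (-m) m) ∧
      ‖(∫ z in Ioo (-m) m, signWeight x z ∂P) -
        ((fplus / (fminus + fplus) : ℝ) * x + (1 - (fplus / (fminus + fplus) : ℝ))) *
          P.real (Ioo (-m) m)‖ ≤ η * P.real (Ioo (-m) m) := by
  set S := fminus + fplus with hS
  -- The `1` in the minimum keeps `η' ≤ S / 4`, hence `P(-m, m) ≥ m * S / 2 > 0`; the `η` then turns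
  -- the final error `2 * η' * m` into one relative to `P(-m, m)`.
  set η' := min 1 η * S / 4 with hη'
  have hmin : 0 < min 1 η := lt_min one_pos hη
  have hη'0 : 0 < η' := by positivity
  have hη'1 : 4 * η' ≤ S := by
    rw [hη']; nlinarith [min_le_left 1 η]
  have hη'2 : 4 * η' ≤ η * S := by
    rw [hη']; nlinarith [min_le_right 1 η]
  have e1 : ∀ᶠ z in 𝓝[>] (0 : ℝ), |f z - fplus| ≤ η' := by
    filter_upwards [hplus (Metric.closedBall_mem_nhds fplus hη'0)] with z hz
    simpa [Real.dist_eq] using hz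
  have e2 : ∀ᶠ z in 𝓝[<] (0 : ℝ), |f z - fminus| ≤ η' := by
    filter_upwards [hminus (Metric.closedBall_mem_nhds fminus hη'0)] with z hz
    simpa [Real.dist_eq] using hz
  obtain ⟨u, hu0, hu⟩ := mem_nhdsGT_iff_exists_Ioo_subset.1 e1
  obtain ⟨l, hl0, hl⟩ := mem_nhdsLT_iff_exists_Ioo_subset.1 e2
  rw [mem_Ioi] at hu0
  rw [mem_Iio] at hl0
  refine ⟨min δ (min u (-l)), by simp [hδ, hu0, hl0], fun m hm' => ?_⟩
  obtain ⟨hm0, hmle⟩ := hm'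
  obtain ⟨hmδ, hmle⟩ := le_min_iff.1 hmle
  obtain ⟨hmu, hml⟩ := le_min_iff.1 hmle
  have ha := hf.abs_measureReal_sub_le (t := Ico 0 m) (c := fplus) (η := η') measurableSet_Ico
    (fun z hz => ⟨by linarith [hz.1], by linarith [hz.2]⟩) hm0.le (by simp)
    fun z hz hz0 => hu ⟨lt_of_le_of_ne hz.1 hz0.symm, by linarith [hz.2]⟩
  have hb := hf.abs_measureReal_sub_le (t := Ioo (-m) 0) (c := fminus) (η := η') measurableSet_Ioo
    (fun z hz => ⟨by linarith [hz.1], by linarith [hz.2]⟩) hm0.le (by simp)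
    fun z hz hz0 => hl ⟨by linarith [hz.1], hz.2⟩
  rw [setIntegral_signWeight x hm0, measureReal_Ioo_neg hm0]
  set a := P.real (Ico 0 m)
  set b := P.real (Ioo (-m) 0)
  rw [abs_le] at ha hb
  have hab : m * S ≤ 2 * (a + b) := by nlinarith
  -- The main terms `fplus * m` and `fminus * m` cancel, so only the two errors remain, with weights
  -- `fminus / S` and `fplus / S` that sum to `1`.
  have hdiff : |a - fplus / S * (a + b)| ≤ η' * m := by
    have heq : a - fplus / S * (a + b) = ((a - fplus * m) * fminus - (b - fminus * m) * fplus) / S := by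
      field_simp; rw [hS]; ring
    rw [heq, abs_div, abs_of_pos hpos, div_le_iff₀ hpos, abs_le]
    constructor <;> nlinarith
  refine ⟨by nlinarith [mul_pos hm0 hpos], ?_⟩
  have heq : (a : ℂ) * x + b - ((fplus / S : ℝ) * x + (1 - (fplus / S : ℝ))) * (a + b : ℝ) =
      ((a - fplus / S * (a + b) : ℝ) : ℂ) * (x - 1) := by push_cast; ring
  rw [heq, norm_mul, Complex.norm_real, Real.norm_eq_abs]
  have hx1 : ‖x - 1‖ ≤ 2 := (norm_sub_le _ _).trans (by simp [hx]; norm_num)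
  calc _ ≤ η' * m * 2 := by gcongr
    _ ≤ η * (a + b) := by nlinarith

end Density

/-! ### Comparison of the weights at `x` and at `1` -/

/-- Telescoping. The error stays relative to `r ^ q`, so that after summation over all `A` it is
controlled by a total probability and not by the number of sets. -/
theorem norm_pow_sub_mul_pow_le {u c : ℂ} {r η : ℝ} (hu : ‖u‖ ≤ r) (hc : ‖c‖ ≤ 1)
    (h : ‖u - c * r‖ ≤ η * r) (q : ℕ) : ‖u ^ q - c ^ q * (r : ℂ) ^ q‖ ≤ q * η * r ^ q := by
  have hr : 0 ≤ r := (norm_nonneg u).trans hu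
  induction q with
  | zero => simp
  | succ q ih =>
    have heq : u ^ (q + 1) - c ^ (q + 1) * (r : ℂ) ^ (q + 1) =
        u ^ q * (u - c * r) + (u ^ q - c ^ q * (r : ℂ) ^ q) * (c * r) := by ring
    have hcr : ‖c * (r : ℂ)‖ ≤ r := by
      rw [norm_mul, Complex.norm_real, Real.norm_of_nonneg hr]
      exact mul_le_of_le_one_left hr hc
    rw [heq]
    refine (norm_add_le _ _).trans ?_
    rw [norm_mul, norm_mul, norm_pow]
    have h1 : ‖u‖ ^ q * ‖u - c * r‖ ≤ r ^ q * (η * r) := by gcongr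
    have h2 := mul_le_mul ih hcr (norm_nonneg _) ((norm_nonneg _).trans ih)
    push_cast
    calc _ ≤ r ^ q * (η * r) + q * η * r ^ q * r := add_le_add h1 h2
      _ = _ := by ring

theorem exists_closerSet_eq_Ioo {κ : Type*} [Finite κ] {w : κ → ℝ} {ε : ℝ}
    (h : ∃ j, |w j| ≤ ε) : ∃ m ≤ ε, 0 ≤ m ∧ closerSet w = Ioo (-m) m := by
  obtain ⟨j₀, hj₀⟩ := h
  have : Nonempty κ := ⟨j₀⟩
  obtain ⟨j, hj⟩ := Finite.exists_min fun j => |w j|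
  refine ⟨|w j|, (hj j₀).trans hj₀, abs_nonneg _, ?_⟩
  ext z
  rw [mem_Ioo, ← abs_lt]
  exact ⟨fun hz => hz j, fun hz i => hz.trans_le (hj i)⟩

theorem signWeight_one : signWeight 1 = fun _ => 1 := by
  ext z; simp [signWeight]

section Estimate

variable {κ ι : Type*} [Fintype κ] (P : Measure ℝ) [IsProbabilityMeasure P] {x c : ℂ} {ε η : ℝ}

theorem integrable_measureReal_closerSet_pow (q : ℕ) :
    Integrable (fun w : κ → ℝ => P.real (closerSet w) ^ q) (Measure.pi fun _ => P) := by
  have := (integrable_setIntegral_closerSet_pow (κ := κ) P (x := 1) (by simp) q).re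
  simp only [signWeight_one, integral_const, measureReal_restrict_apply_univ] at this
  refine this.congr (Eventually.of_forall fun w => ?_)
  simp [← Complex.ofReal_pow]

/-- If some outside value is within `ε` of `0`, the set of closer reals is an interval `(-m, m)`
with `m ≤ ε` and the hypothesis applies. Otherwise both powers have norm at most `1`, which gives
the term `2 * P.real {z | ε < |z|} ^ card κ`. -/
theorem norm_integral_pow_sub_le (hx : ‖x‖ = 1) (hc : ‖c‖ ≤ 1) (hη : 0 ≤ η)
    (h : ∀ m ∈ Ioc 0 ε, ‖(∫ z in Ioo (-m) m, signWeight x z ∂P) - c * P.real (Ioo (-m) m)‖ ≤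
      η * P.real (Ioo (-m) m)) (q : ℕ) :
    ‖(∫ w : κ → ℝ, (∫ z in closerSet w, signWeight x z ∂P) ^ q ∂Measure.pi fun _ => P) -
      c ^ q * (∫ w : κ → ℝ, P.real (closerSet w) ^ q ∂Measure.pi fun _ => P : ℝ)‖ ≤
      q * η * (∫ w : κ → ℝ, P.real (closerSet w) ^ q ∂Measure.pi fun _ => P) +
        2 * P.real {z | ε < |z|} ^ Fintype.card κ := by
  have hr := integrable_measureReal_closerSet_pow (κ := κ) P q
  have hu := integrable_setIntegral_closerSet_pow (κ := κ) P hx q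
  have hms : MeasurableSet {z : ℝ | ε < |z|} := measurableSet_lt (by fun_prop) (by fun_prop)
  let far : Set (κ → ℝ) := univ.pi fun _ => {z | ε < |z|}
  have hmfar : MeasurableSet far := MeasurableSet.univ_pi fun _ => hms
  have hPfar : (Measure.pi fun _ : κ => P).real far = P.real {z | ε < |z|} ^ Fintype.card κ := by
    simp [far, measureReal_def, Measure.pi_pi]
  have hind : Integrable (far.indicator (1 : (κ → ℝ) → ℝ)) (Measure.pi fun _ => P) :=
    (integrable_const (1 : ℝ)).indicator hmfar
  have hnu : ∀ w : κ → ℝ, ‖∫ z in closerSet w, signWeight x z ∂P‖ ≤ P.real (closerSet w) := by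
    intro w
    simpa using norm_setIntegral_le_of_norm_le_const (μ := P) (s := closerSet w) (C := 1)
      (measure_lt_top _ _) fun z _ => (norm_signWeight hx z).le
  rw [← integral_complex_ofReal, ← integral_const_mul, ← integral_sub hu
    (by exact hr.ofReal.const_mul _), ← hPfar, ← integral_indicator_one hmfar,
    ← integral_const_mul, ← integral_const_mul, ← integral_add (hr.const_mul _) (hind.const_mul 2)]
  refine norm_integral_le_of_norm_le ((hr.const_mul _).add (hind.const_mul 2)) (Eventually.of_forall fun w => ?_)
  push_cast
  have hr0 : 0 ≤ P.real (closerSet w) := measureReal_nonneg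
  by_cases hw : w ∈ far
  · have hr1 : P.real (closerSet w) ≤ 1 := measureReal_le_one
    have h1 : ‖(∫ z in closerSet w, signWeight x z ∂P) ^ q‖ ≤ 1 := by
      rw [norm_pow]
      exact pow_le_one₀ (norm_nonneg _) ((hnu w).trans hr1)
    have h2 : ‖c ^ q * (P.real (closerSet w) : ℂ) ^ q‖ ≤ 1 := by
      rw [← mul_pow, norm_pow, norm_mul, Complex.norm_real, Real.norm_of_nonneg hr0]
      exact pow_le_one₀ (by positivity) (mul_le_one₀ hc hr0 hr1)
    have h3 : 0 ≤ q * η * P.real (closerSet w) ^ q := by positivity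
    simp only [indicator_of_mem hw, Pi.one_apply]
    linarith [norm_sub_le ((∫ z in closerSet w, signWeight x z ∂P) ^ q)
      (c ^ q * (P.real (closerSet w) : ℂ) ^ q)]
  · rw [indicator_of_notMem hw, mul_zero, add_zero]
    refine norm_pow_sub_mul_pow_le (hnu w) hc ?_ q
    obtain ⟨m, hmε, hm0, hm⟩ := exists_closerSet_eq_Ioo (w := w) (ε := ε)
      (by simpa [far, Set.mem_pi] using hw)
    rw [hm]
    obtain rfl | hm0 := hm0.eq_or_lt
    · simp
    · exact h m ⟨hm0, hmε⟩

variable [Fintype ι]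

theorem integral_closestWeight_one [DecidableEq ι] (A : Finset ι) :
    ∫ z, closestWeight 1 A z ∂Measure.pi (fun _ : ι => P) =
      (∫ w, P.real (closerSet w) ^ A.card ∂Measure.pi fun _ : {j // j ∉ A} => P : ℝ) := by
  rw [integral_closestWeight P (by simp), ← integral_complex_ofReal]
  simp [signWeight_one]

theorem integrable_closestWeight (hx : ‖x‖ = 1) (A : Finset ι) :
    Integrable (closestWeight x A) (Measure.pi fun _ : ι => P) :=
  Integrable.of_bound (measurable_closestWeight x A).aestronglyMeasurable 1
    (Eventually.of_forall fun z => norm_closestWeight_le hx A z)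

theorem integral_sum_closestWeight (hx : ‖x‖ = 1) (q : ℕ) :
    ∫ z, ∑ A ∈ Finset.powersetCard q Finset.univ, closestWeight x A z
        ∂Measure.pi (fun _ : ι => P) =
      ∑ A ∈ Finset.powersetCard q Finset.univ,
        ∫ z, closestWeight x A z ∂Measure.pi (fun _ : ι => P) :=
  integral_finsetSum _ fun A _ => integrable_closestWeight P hx A

theorem norm_integral_sum_closestWeight_sub_le [DecidableEq ι] (hx : ‖x‖ = 1) (hc : ‖c‖ ≤ 1) (hη : 0 ≤ η)
    (h : ∀ m ∈ Ioc 0 ε, ‖(∫ z in Ioo (-m) m, signWeight x z ∂P) - c * P.real (Ioo (-m) m)‖ ≤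
      η * P.real (Ioo (-m) m)) (q : ℕ) :
    ‖(∫ z, ∑ A ∈ Finset.powersetCard q Finset.univ, closestWeight x A z
        ∂Measure.pi fun _ : ι => P) -
      c ^ q * ∫ z, ∑ A ∈ Finset.powersetCard q Finset.univ, closestWeight 1 A z
        ∂Measure.pi fun _ : ι => P‖ ≤
      q * η + 2 * ((Fintype.card ι).choose q * P.real {z | ε < |z|} ^ (Fintype.card ι - q)) := by
  -- At `x = 1` the sum is the indicator that some `q`-set separates; this bounds the accumulated
  -- relative errors by `q * η`.
  have hone : ‖∫ z, ∑ A ∈ Finset.powersetCard q Finset.univ, closestWeight 1 A z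
      ∂Measure.pi fun _ : ι => P‖ ≤ 1 := by
    simpa using norm_integral_le_of_norm_le_const (μ := Measure.pi fun _ : ι => P)
      (Eventually.of_forall fun z => norm_sum_closestWeight_le (x := 1) (by simp) q z)
  rw [integral_sum_closestWeight P (x := 1) (by simp)] at hone ⊢
  rw [integral_sum_closestWeight P hx, Finset.mul_sum,
    ← Finset.sum_sub_distrib]
  simp_rw [integral_closestWeight_one] at hone ⊢
  rw [← Complex.ofReal_sum, Complex.norm_real] at hone
  have hterm : ∀ A ∈ Finset.powersetCard q (Finset.univ : Finset ι),
      ‖(∫ z, closestWeight x A z ∂Measure.pi (fun _ : ι => P)) -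
        c ^ q * (∫ w, P.real (closerSet w) ^ A.card ∂Measure.pi fun _ : {j // j ∉ A} => P : ℝ)‖ ≤
      q * η * (∫ w, P.real (closerSet w) ^ A.card ∂Measure.pi fun _ : {j // j ∉ A} => P) +
        2 * P.real {z | ε < |z|} ^ (Fintype.card ι - q) := by
    intro A hA
    have hq := (Finset.mem_powersetCard.1 hA).2
    have hcard : Fintype.card {j // j ∉ A} = Fintype.card ι - q := by
      rw [Fintype.card_subtype_compl]; simp [hq]
    rw [integral_closestWeight P hx, hq, ← hcard]
    exact norm_integral_pow_sub_le P hx hc hη h q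
  refine (norm_sum_le_of_le _ hterm).trans ?_
  rw [Finset.sum_add_distrib, ← Finset.mul_sum, Finset.sum_const, Finset.card_powersetCard,
    Finset.card_univ, nsmul_eq_mul]
  have h0 : 0 ≤ q * η := by positivity
  have := mul_le_mul_of_nonneg_left ((le_abs_self _).trans hone) h0
  linarith

end Estimate

/-! ### Almost sure behaviour of the sample and the limit -/

section Sample

variable {Ω : Type*} [MeasurableSpace Ω] {μ : Measure Ω} {P : Measure ℝ} {Z : ℕ → Ω → ℝ}
  {f : ℝ → ℝ} {δ : ℝ}

/-- Each slice lies in `{a, -a}` and in `(-δ, δ)`, where `P` has no atoms. -/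
theorem HasDensityOn.prod_abs_eq_null [SFinite P] (hf : HasDensityOn P f (Ioo (-δ) δ)) :
    (P.prod P) {p | |p.1| = |p.2| ∧ |p.1| < δ} = 0 := by
  have hms : MeasurableSet {p : ℝ × ℝ | |p.1| = |p.2| ∧ |p.1| < δ} :=
    (measurableSet_eq_fun (measurable_fst.norm) (measurable_snd.norm)).inter
      (measurableSet_lt (measurable_fst.norm) measurable_const)
  refine (Measure.measure_prod_null hms).2 (Eventually.of_forall fun a => ?_)
  refine hf.null_of_subset measurableSet_Ioo (fun b hb => ?_) ?_
  · exact abs_lt.1 (hb.1 ▸ hb.2 : |b| < δ)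
  · have hsub : Prod.mk a ⁻¹' {p : ℝ × ℝ | |p.1| = |p.2| ∧ |p.1| < δ} ⊆ {a, -a} :=
      fun b hb => abs_eq_abs.1 (hb.1 : |a| = |b|).symm
    exact measure_mono_null hsub ((Set.toFinite {a, -a}).measure_zero volume)

theorem aemeasurable_signCount {n : ℕ} {Y : Fin n → Ω → ℝ} (hY : ∀ j, AEMeasurable (Y j) μ)
    (q : ℕ) : AEMeasurable (fun ω => signCount q fun j => Y j ω) μ := by
  have : Measurable fun y : Fin n → ℝ => signCount q y := by
    refine Finset.measurable_sum _ fun j _ => Measurable.ite ?_ measurable_const measurable_const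
    exact (MeasurableSet.const _).inter (measurableSet_le measurable_const (measurable_pi_apply j))
  exact this.comp_aemeasurable (aemeasurable_pi_lambda _ hY)

theorem map_sample_eq_pi [IsProbabilityMeasure μ] (hindep : iIndepFun Z μ) (hlaw : ∀ i, HasLaw (Z i) P μ) (n : ℕ) :
    μ.map (fun ω (i : Fin n) => Z i ω) = Measure.pi fun _ => P := by
  have h := (iIndepFun_iff_map_fun_eq_pi_map (f := fun i : Fin n => Z i)
    fun i => (hlaw i).aemeasurable).1 (hindep.precomp Fin.val_injective)
  simpa only [(hlaw _).map_eq] using h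

variable [IsProbabilityMeasure P]

/-- Infinitely many observations fall below any level of positive probability. -/
theorem ae_eventually_le_card (hindep : iIndepFun Z μ) (hlaw : ∀ i, HasLaw (Z i) P μ)
    (hP : 0 < P.real {z | |z| < δ}) (q : ℕ) :
    ∀ᵐ ω ∂μ, ∀ᶠ n in atTop,
      q ≤ (Finset.univ.filter fun i : Fin n => |Z i ω| < δ).card := by
  have hms : MeasurableSet {z : ℝ | |z| < δ} := measurableSet_lt (by fun_prop) (by fun_prop)
  set g : ℝ → ℝ := {z | |z| < δ}.indicator 1 with hg
  have hgm : Measurable g := measurable_one.indicator hms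
  have hgi : Integrable g P := (integrable_const (1 : ℝ)).indicator hms
  have hmean : μ[fun ω => g (Z 0 ω)] = P.real {z | |z| < δ} := by
    rw [← integral_indicator_one hms, ← (hlaw 0).map_eq,
      integral_map (hlaw 0).aemeasurable hgm.aestronglyMeasurable]
  have hslln := strong_law_ae_real (μ := μ) (fun i ω => g (Z i ω))
    (by
      have : Integrable g (μ.map (Z 0)) := by rwa [(hlaw 0).map_eq]
      exact this.comp_aemeasurable (hlaw 0).aemeasurable)
    (fun i j hij => (hindep.indepFun hij).comp hgm hgm)
    (fun i => IdentDistrib.comp ⟨(hlaw i).aemeasurable, (hlaw 0).aemeasurable,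
      by rw [(hlaw i).map_eq, (hlaw 0).map_eq]⟩ hgm)
  filter_upwards [hslln] with ω hω
  rw [hmean] at hω
  have htop : Tendsto (fun n : ℕ => ∑ i ∈ Finset.range n, g (Z i ω)) atTop atTop := by
    refine (hω.pos_mul_atTop hP tendsto_natCast_atTop_atTop).congr' ?_
    filter_upwards [eventually_ne_atTop 0] with n hn
    field_simp
  filter_upwards [htop.eventually_ge_atTop (q : ℝ)] with n hn
  rw [← Fin.sum_univ_eq_sum_range (fun i => g (Z i ω))] at hn
  have : ∑ i : Fin n, g (Z i ω) =
      ((Finset.univ.filter fun i : Fin n => |Z i ω| < δ).card : ℝ) := by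
    simp [hg, indicator_apply]
  rw [this] at hn
  exact_mod_cast hn

variable [IsProbabilityMeasure μ]

theorem ae_le_abs_of_tie (hindep : iIndepFun Z μ) (hlaw : ∀ i, HasLaw (Z i) P μ)
    (hf : HasDensityOn P f (Ioo (-δ) δ)) :
    ∀ᵐ ω ∂μ, ∀ i j, i ≠ j → |Z i ω| = |Z j ω| → δ ≤ |Z i ω| := by
  simp only [ae_all_iff, eventually_imp_distrib_left]
  intro i j hij
  have hmap : μ.map (fun ω => (Z i ω, Z j ω)) = P.prod P := by
    rw [(indepFun_iff_map_prod_eq_prod_map_map (hlaw i).aemeasurable (hlaw j).aemeasurable).1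
      (hindep.indepFun hij), (hlaw i).map_eq, (hlaw j).map_eq]
  have hae : ∀ᵐ p ∂μ.map (fun ω => (Z i ω, Z j ω)), ¬ (|p.1| = |p.2| ∧ |p.1| < δ) := by
    rw [hmap, ae_iff]
    simpa using hf.prod_abs_eq_null
  filter_upwards [ae_of_ae_map ((hlaw i).aemeasurable.prodMk (hlaw j).aemeasurable) hae] with ω hω he
  exact not_lt.1 fun hlt => hω ⟨he, hlt⟩

/-- The generating function of the sign count is asymptotically a sum of the contributions of all
possible sets of `q` closest observations. -/
theorem tendsto_integral_pow_signCount_sub (hindep : iIndepFun Z μ)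
    (hlaw : ∀ i, HasLaw (Z i) P μ) (hf : HasDensityOn P f (Ioo (-δ) δ))
    (hP : 0 < P.real {z | |z| < δ}) (q : ℕ) {Y : (n : ℕ) → Fin n → Ω → ℝ}
    (hYmeas : ∀ n j, AEMeasurable (Y n j) μ)
    (hY : ∀ n, ∀ᵐ ω ∂μ,
      IsGOrderStatistics (fun z => |z|) (fun i : Fin n => Z i ω) (fun j => Y n j ω))
    {x : ℂ} (hx : ‖x‖ = 1) :
    Tendsto (fun n => (∫ ω, x ^ signCount q (fun j => Y n j ω) ∂μ) -
      ∫ z, ∑ A ∈ Finset.powersetCard q Finset.univ, closestWeight x A z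
        ∂Measure.pi fun _ : Fin n => P) atTop (𝓝 0) := by
  have hZ : ∀ n, AEMeasurable (fun ω (i : Fin n) => Z i ω) μ := fun n =>
    aemeasurable_pi_lambda _ fun i => (hlaw i).aemeasurable
  have hWm : ∀ n, Measurable fun z : Fin n → ℝ =>
      ∑ A ∈ Finset.powersetCard q Finset.univ, closestWeight x A z := fun n =>
    Finset.measurable_sum _ fun A _ => measurable_closestWeight x A
  have hSm : ∀ n, AEStronglyMeasurable (fun ω => x ^ signCount q (fun j => Y n j ω)) μ := fun n =>
    ((measurable_of_countable fun k : ℕ => x ^ k).comp_aemeasurable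
      (aemeasurable_signCount (hYmeas n) q)).aestronglyMeasurable
  have hWZm : ∀ n, AEStronglyMeasurable (fun ω =>
      ∑ A ∈ Finset.powersetCard q Finset.univ, closestWeight x A fun i : Fin n => Z i ω) μ :=
    fun n => ((hWm n).comp_aemeasurable (hZ n)).aestronglyMeasurable
  have hSb : ∀ n ω, ‖x ^ signCount q (fun j => Y n j ω)‖ ≤ 1 := fun n ω => by simp [hx]
  have hlim : Tendsto (fun n => ∫ ω, (x ^ signCount q (fun j => Y n j ω) -
      ∑ A ∈ Finset.powersetCard q Finset.univ, closestWeight x A fun i : Fin n => Z i ω) ∂μ)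
      atTop (𝓝 (∫ _, (0 : ℂ) ∂μ)) := by
    refine tendsto_integral_of_dominated_convergence (fun _ => 2)
      (fun n => (hSm n).sub (hWZm n)) (integrable_const _) (fun n => ?_) ?_
    · refine Eventually.of_forall fun ω => (norm_sub_le _ _).trans ?_
      linarith [hSb n ω, norm_sum_closestWeight_le hx q fun i : Fin n => Z i ω]
    -- Almost surely the two integrands agree exactly for all large `n`, so dominated convergence
    -- applies.
    · filter_upwards [ae_all_iff.2 hY, ae_le_abs_of_tie hindep hlaw hf,
        ae_eventually_le_card hindep hlaw hP q] with ω h1 h2 h3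
      refine tendsto_const_nhds.congr' ?_
      filter_upwards [h3] with n hn
      obtain ⟨A, hA, hsep, hS⟩ := exists_separates_of_isGOrderStatistics (h1 n)
        (fun i j hij => h2 i j (Fin.val_injective.ne hij)) hn
      rw [sum_closestWeight_eq hsep hA, prod_signWeight, hS, sub_self]
  rw [integral_zero] at hlim
  refine hlim.congr fun n => ?_
  rw [integral_sub (Integrable.of_bound (hSm n) 1 (Eventually.of_forall (hSb n)))
    (Integrable.of_bound (hWZm n) 1 (Eventually.of_forall fun ω =>
      norm_sum_closestWeight_le hx q _)), ← map_sample_eq_pi hindep hlaw,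
    integral_map (hZ n) (hWm n).aestronglyMeasurable]

/-- The binomial coefficient is at most `n ^ q`, which geometric decay beats. -/
theorem tendsto_choose_mul_pow {r : ℝ} (hr0 : 0 ≤ r) (hr1 : r < 1) (q : ℕ) :
    Tendsto (fun n : ℕ => (n.choose q : ℝ) * r ^ (n - q)) atTop (𝓝 0) := by
  obtain rfl | hr0 := hr0.eq_or_lt
  · refine tendsto_const_nhds.congr' ?_
    filter_upwards [eventually_gt_atTop q] with n hn
    simp [Nat.sub_ne_zero_of_lt hn]
  have h := (tendsto_pow_const_mul_const_pow_of_abs_lt_one q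
    (by rwa [abs_of_pos hr0])).mul_const (r ^ q)⁻¹
  rw [zero_mul] at h
  refine squeeze_zero' (Eventually.of_forall fun n => by positivity) ?_ h
  filter_upwards [eventually_ge_atTop q] with n hn
  rw [pow_sub₀ _ hr0.ne' hn, mul_assoc]
  gcongr
  exact_mod_cast Nat.choose_le_pow n q

/-- The generating function of the sign count converges to that of the binomial distribution. -/
theorem tendsto_integral_pow_signCount (hindep : iIndepFun Z μ)
    (hlaw : ∀ i, HasLaw (Z i) P μ) (hδ : 0 < δ) (hf : HasDensityOn P f (Ioo (-δ) δ))
    {fplus fminus : ℝ} (hplus : Tendsto f (𝓝[>] 0) (𝓝 fplus))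
    (hminus : Tendsto f (𝓝[<] 0) (𝓝 fminus)) (hp : 0 ≤ fplus) (hm : 0 ≤ fminus)
    (hpos : 0 < fminus + fplus) (q : ℕ) {Y : (n : ℕ) → Fin n → Ω → ℝ}
    (hYmeas : ∀ n j, AEMeasurable (Y n j) μ)
    (hY : ∀ n, ∀ᵐ ω ∂μ,
      IsGOrderStatistics (fun z => |z|) (fun i : Fin n => Z i ω) (fun j => Y n j ω))
    {x : ℂ} (hx : ‖x‖ = 1) :
    Tendsto (fun n => ∫ ω, x ^ signCount q (fun j => Y n j ω) ∂μ) atTop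
      (𝓝 (((fplus / (fminus + fplus) : ℝ) * x + (1 - (fplus / (fminus + fplus) : ℝ))) ^ q)) := by
  have hnear := fun {η : ℝ} (hη : 0 < η) =>
    hf.exists_norm_setIntegral_signWeight_sub_le hδ hplus hminus hp hm hpos hx hη
  set π := fplus / (fminus + fplus) with hπ
  set c : ℂ := π * x + (1 - π) with hc_def
  have hπ0 : 0 ≤ π := by positivity
  have hπ1 : π ≤ 1 := (div_le_one hpos).2 (by linarith)
  have hc : ‖c‖ ≤ 1 := by
    have h1 : ‖(1 - π : ℂ)‖ = 1 - π := by
      rw [← Complex.ofReal_one, ← Complex.ofReal_sub, Complex.norm_real,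
        Real.norm_of_nonneg (by linarith)]
    refine (norm_add_le _ _).trans ?_
    rw [norm_mul, hx, h1, Complex.norm_real, Real.norm_of_nonneg hπ0]
    linarith
  have hset : ∀ m : ℝ, {z : ℝ | |z| < m} = Ioo (-m) m := fun m => by ext; simp [abs_lt]
  have hP : 0 < P.real {z | |z| < δ} := by
    obtain ⟨ε, hε, h⟩ := hnear one_pos
    refine (h (min ε δ) ⟨lt_min hε hδ, min_le_left _ _⟩).1.trans_le ?_
    rw [← hset]
    exact measureReal_mono fun z (hz : |z| < min ε δ) => lt_of_lt_of_le hz (min_le_right _ _)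
  have hx_lim := tendsto_integral_pow_signCount_sub hindep hlaw hf hP q hYmeas hY hx
  have hone_lim := tendsto_integral_pow_signCount_sub hindep hlaw hf hP q hYmeas hY
    (x := 1) (by simp)
  set F : ℂ → ℕ → ℂ := fun x n =>
    ∫ z, ∑ A ∈ Finset.powersetCard q Finset.univ, closestWeight x A z
      ∂Measure.pi fun _ : Fin n => P with hF
  have hdiff : Tendsto (fun n => F x n - c ^ q * F 1 n) atTop (𝓝 0) := by
    rw [Metric.tendsto_atTop']
    intro e he
    -- Chosen so that `q * η ≤ e / 2`; the `+ 1` keeps the denominator positive at `q = 0`.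
    have hη : 0 < e / (2 * (q + 1)) := by positivity
    obtain ⟨ε, hε, h⟩ := hnear hη
    have hfar : P.real {z | ε < |z|} < 1 := by
      have hms : MeasurableSet {z : ℝ | |z| < ε} := measurableSet_lt (by fun_prop) (by fun_prop)
      have h1 : P.real {z | ε < |z|} ≤ P.real {z | |z| < ε}ᶜ :=
        measureReal_mono fun z (hz : ε < |z|) => not_lt.2 hz.le
      have h2 := (h ε ⟨hε, le_rfl⟩).1
      rw [probReal_compl_eq_one_sub hms, hset] at h1
      linarith
    have hsmall := (tendsto_choose_mul_pow measureReal_nonneg hfar q).const_mul 2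
    rw [mul_zero] at hsmall
    obtain ⟨N, hN⟩ := eventually_atTop.1 (hsmall.eventually (gt_mem_nhds (half_pos he)))
    refine ⟨N, fun n hn => ?_⟩
    rw [dist_zero_right]
    have hb := norm_integral_sum_closestWeight_sub_le (ι := Fin n) P hx hc hη.le
      (fun m hm => (h m hm).2) q
    rw [Fintype.card_fin] at hb
    have hq : q * (e / (2 * (q + 1))) ≤ e / 2 := by
      rw [mul_div_assoc', div_le_div_iff₀ (by positivity) two_pos]
      nlinarith
    linarith [hN n hn.le]
  -- At `x = 1` the generating function of the sign count is identically `1`.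
  have h1 : Tendsto (F 1) atTop (𝓝 1) := by
    have := tendsto_const_nhds (x := (1 : ℂ)).sub hone_lim
    simpa using this
  have h := (hx_lim.add hdiff).add (h1.const_mul (c ^ q))
  simp only [zero_add, mul_one] at h
  exact h.congr fun n => by ring

end Sample

/-! ### Characteristic functions and conclusion -/

theorem charFun_map_cast_binomial (q : ℕ) (p : unitInterval) (t : ℝ) :
    charFun ((binomial q p).map (Nat.cast : ℕ → ℝ)) t =
      ((p : ℝ) * Complex.exp (t * Complex.I) + (1 - (p : ℝ))) ^ q := by
  rw [charFun_apply_real, integral_map_cast_binomial, add_pow, ← Nat.range_succ_eq_Iic]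
  refine Finset.sum_congr rfl fun k _ => ?_
  rw [Complex.real_smul, mul_pow, ← Complex.exp_nat_mul]
  push_cast
  ring_nf

theorem theorem4p1 {Ω : Type*} [MeasurableSpace Ω] (μ : Measure Ω) [IsProbabilityMeasure μ]
    -- an i.i.d. sample from the distribution `P`
    (P : Measure ℝ) (Z : ℕ → Ω → ℝ)
    (hindep : iIndepFun Z μ) (hlaw : ∀ i, HasLaw (Z i) P μ)
    -- the conditions on the density of `P` near `0`
    (δ : ℝ) (hδ : 0 < δ) (f : ℝ → ℝ) (hf : HasDensityOn P f (Ioo (-δ) δ))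
    (hbdd : BddAbove (f '' Ioo (-δ) δ))
    (fplus fminus : ℝ)
    (hplus : Tendsto f (𝓝[>] 0) (𝓝 fplus)) (hminus : Tendsto f (𝓝[<] 0) (𝓝 fminus))
    (hpos : 0 < fminus + fplus)
    (q : ℕ) (hq : 1 ≤ q)
    -- for every `n`, random variables that are `|·|`-order statistics of the first `n` observations
    (Y : (n : ℕ) → Fin n → Ω → ℝ) (hYmeas : ∀ n j, AEMeasurable (Y n j) μ)
    (hY : ∀ n, ∀ᵐ ω ∂μ,
      IsGOrderStatistics (fun z => |z|) (fun i : Fin n => Z i ω) (fun j => Y n j ω)) :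
    ∃ hπ : fplus / (fminus + fplus) ∈ unitInterval,
      TendstoInDistribution
        (fun (n : ℕ) (ω : Ω) => (signCount q (fun j => Y n j ω) : ℝ)) atTop
        (fun k : ℕ => (k : ℝ)) (fun _ => μ)
        (binomial q ⟨fplus / (fminus + fplus), hπ⟩) := by
  have : IsProbabilityMeasure P := (hlaw 0).map_eq ▸
    Measure.isProbabilityMeasure_map (hlaw 0).aemeasurable
  have hp : 0 ≤ fplus := ge_of_tendsto hplus <| by
    filter_upwards [Ioo_mem_nhdsGT hδ] with z hz using hf.nonneg z ⟨by linarith [hz.1], hz.2⟩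
  have hm : 0 ≤ fminus := ge_of_tendsto hminus <| by
    filter_upwards [Ioo_mem_nhdsLT (neg_neg_of_pos hδ)] with z hz
      using hf.nonneg z ⟨hz.1, by linarith [hz.2]⟩
  have hcast : ∀ n, AEMeasurable (fun ω => (signCount q (fun j => Y n j ω) : ℝ)) μ := fun n =>
    measurable_from_nat.comp_aemeasurable (aemeasurable_signCount (hYmeas n) q)
  refine ⟨⟨by positivity, (div_le_one hpos).2 (by linarith)⟩, hcast,
    measurable_from_nat.aemeasurable, ProbabilityMeasure.tendsto_iff_tendsto_charFun.2 fun t => ?_⟩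
  simp only [ProbabilityMeasure.coe_mk]
  rw [charFun_map_cast_binomial]
  refine (tendsto_integral_pow_signCount hindep hlaw hδ hf hplus hminus hp hm hpos q hYmeas hY
    (Complex.norm_exp_ofReal_mul_I t)).congr fun n => ?_
  rw [charFun_apply_real, integral_map (hcast n) (by fun_prop)]
  refine integral_congr_ae (Eventually.of_forall fun ω => ?_)
  simp only [← Complex.exp_nat_mul]
  push_cast
  ring_nf
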